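/- Let $K$ be a field, let $n\ge 1$, and let $G$ be a connected simple graph on the vertex set $[n]=\{1,\dots,n\}$. Let $S=K[x_1,\dots,x_n,y_1,\dots,y_n]$ with its standard grading, and for a simple graph $H$ on $[n]$ let $$J_H=\bigl(x_iy_j-x_jy_i : \{i,j\}\in E(H),\ i<j\bigr)\subseteq S$$ be its binomial edge ideal. Write $\mathcal K_n$ for the complete graph on $[n]$. A prime ideal $\mathfrak p$ of $S$ is an associated prime of a homogeneous ideal $I$ if $\mathfrak p=(I:f)$ for some homogeneous $f\in S$, and in that case the localized v-number of $I$ at $\mathfrak p$ is $$\mathrm v_{\mathfrak p}(I)=\min\{d\ge 0 : (I:f)=\mathfrak p \text{ for some homogeneous } f\in S \text{ of degree } d\}.$$ A connected dominating set of $G$ is a nonempty set $B\subseteq[n]$ such that the induced subgraph on $B$ is connected and every vertex outside $B$ is adjacent to some vertex of $B$; the connected domination number $\gamma_c(G)$ is the smallest size of such a set. Then $J_{\mathcal K_n}$ is an associated prime of $J_G$, and $$\mathrm v_{J_{\mathcal K_n}}(J_G)=\begin{cases}\gamma_c(G) & \text{if } G\ne\mathcal K_n,\\ 0 & \text{if }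 G=\mathcal K_n.\end{cases}$$ -/

import Mathlib

namespace BinomialEdge

/-- The polynomial ring `K[x₁, …, xₙ, y₁, …, yₙ]`: the index `Sum.inl i` is the variable `xᵢ`, the
index `Sum.inr i` is the variable `yᵢ`. -/
abbrev PolyRing (K : Type*) [Field K] (n : ℕ) : Type _ := MvPolynomial (Fin n ⊕ Fin n) K

/-- The variable `xᵢ`. -/
noncomputable def x (K : Type*) [Field K] {n : ℕ} (i : Fin n) : PolyRing K n :=
  MvPolynomial.X (Sum.inl i)

/-- The variable `yᵢ`. -/
noncomputable def y (K : Type*) [Field K] {n : ℕ} (i : Fin n) : PolyRing K n :=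
  MvPolynomial.X (Sum.inr i)

/-- The binomial edge ideal `J_G`, generated by the `xᵢ yⱼ - xⱼ yᵢ` with `{i, j}` an edge of `G`
and `i < j`. -/
noncomputable def edgeIdeal (K : Type*) [Field K] {n : ℕ} (G : SimpleGraph (Fin n)) :
    Ideal (PolyRing K n) :=
  Ideal.span {f | ∃ i j : Fin n, i < j ∧ G.Adj i j ∧ f = x K i * y K j - x K j * y K i}

/-- The degrees `d` for which some homogeneous polynomial `f` of degree `d` satisfies
`(I : f) = p`. -/
def colonDegrees {σ K : Type*} [Field K] (I p : Ideal (MvPolynomial σ K)) : Set ℕ :=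
  {d | ∃ f : MvPolynomial σ K, f.IsHomogeneous d ∧ I.colon {f} = p}

/-- The associated primes of a graded ideal `I`: the prime ideals of the form `(I : f)` with `f`
homogeneous. -/
def Ass {σ K : Type*} [Field K] (I : Ideal (MvPolynomial σ K)) : Set (Ideal (MvPolynomial σ K)) :=
  {p | p.IsPrime ∧ ∃ (d : ℕ) (f : MvPolynomial σ K), f.IsHomogeneous d ∧ I.colon {f} = p}

/-- The localized v-number of `I` at `p`. It is a minimum when `p ∈ Ass I`. -/
noncomputable def localVNumber {σ K : Type*} [Field K] (I p : Ideal (MvPolynomial σ K)) : ℕ :=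
  sInf (colonDegrees I p)

/-- `B` is a connected dominating set of `G`. -/
def IsConnectedDominating {V : Type*} (G : SimpleGraph V) (B : Finset V) : Prop :=
  (G.induce (B : Set V)).Connected ∧ ∀ v, v ∉ B → ∃ w ∈ B, G.Adj v w

/-- The connected domination number of `G`: the least size of a connected dominating set. -/
noncomputable def connectedDominationNumber {V : Type*} (G : SimpleGraph V) : ℕ :=
  sInf {k | ∃ B : Finset V, IsConnectedDominating G B ∧ B.card = k}

/-- The minimum that defines the localized v-number is attained at every associated prime. -/
theorem localVNumber_mem {σ K : Type*} [Field K] {I p : Ideal (MvPolynomial σ K)}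
    (hp : p ∈ Ass I) : localVNumber I p ∈ colonDegrees I p := by
  obtain ⟨_, d, f, hf, h⟩ := hp
  exact Nat.sInf_mem ⟨d, f, hf, h⟩

/-- The minimum that defines the connected domination number of a connected graph is attained. -/
theorem exists_card_eq_connectedDominationNumber {V : Type*} [Fintype V] {G : SimpleGraph V}
    (hG : G.Connected) :
    ∃ B : Finset V, IsConnectedDominating G B ∧ B.card = connectedDominationNumber G := by
  refine Nat.sInf_mem (s := {k | ∃ B : Finset V, IsConnectedDominating G B ∧ B.card = k})
    ⟨_, Finset.univ, ⟨?_, fun v hv => absurd (Finset.mem_univ v) hv⟩, rfl⟩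
  rw [Finset.coe_univ]
  exact (SimpleGraph.induceUnivIso G).connected_iff.mpr hG

end BinomialEdge

/-! Upper bound: for a connected dominating set `B`, the product of the `x_b`, `b ∈ B`, multiplies
every minor into `J_G`. By `x_mul_minor`, multiplying by `x_b` replaces an endpoint of a minor by
`b`, and this is iterated along a path in `B` (`prod_x_mul_minor_mem`). As `J_{Kₙ}` is prime and
does not contain the product, the colon ideal is exactly `J_{Kₙ}`.

Lower bound: if `(J_G : f) = J_{Kₙ}`, then `f ∉ J_{Kₙ}`, so `f` has nonzero image under `xᵢ ↦ uᵢ`,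
`yᵢ ↦ t uᵢ`, whose kernel is `J_{Kₙ}`. Let `B` be the set of `i` with `uᵢ` in some monomial of the
image; then `|B| ≤ deg f`. If `B` were not connected dominating, some `U ⊇ B` would have a
nonconstant 2-colouring that is constant along edges. Giving each colour its own `t` yields a map to
a domain that kills `J_G` but not every minor, hence kills `f`; identifying the two `t`s and
dropping the `uᵢ` with `i ∉ B` contradicts the choice of monomial. -/

namespace BinomialEdge

open MvPolynomial

/-! ### Homomorphisms sending variables to monomials -/

section Monomials

variable {σ τ K : Type*} [Field K]

/-- A homomorphism that sends variables to monomials sends monomials to monomials. -/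
theorem map_monomial_of_map_X {φ : MvPolynomial σ K →ₐ[K] MvPolynomial τ K}
    {w : σ → τ →₀ ℕ} (hφ : ∀ i, φ (X i) = monomial (w i) 1) (m : σ →₀ ℕ) (c : K) :
    φ (monomial m c) = monomial (Finsupp.linearCombination ℕ w m) c := by
  induction m using Finsupp.induction_linear generalizing c with
  | zero => simp [← C_apply, ← algebraMap_eq]
  | add f g hf hg =>
    rw [map_add, ← mul_one c, ← monomial_mul, map_mul, hf, hg, monomial_mul]
  | single i k =>
    have : (monomial (Finsupp.single i k) c : MvPolynomial σ K) = C c * X i ^ k := by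
      rw [X_pow_eq_monomial, C_mul_monomial, mul_one]
    rw [this, map_mul, map_pow, hφ, monomial_pow, ← algebraMap_eq, AlgHom.commutes, algebraMap_eq,
      C_mul_monomial, Finsupp.linearCombination_single]
    simp

/-- The kernel of a homomorphism that sends variables to monomials is contained in every ideal
that contains the differences of monomials with the same image. -/
theorem ker_le_of_map_X {φ : MvPolynomial σ K →ₐ[K] MvPolynomial τ K}
    {w : σ → τ →₀ ℕ} (hφ : ∀ i, φ (X i) = monomial (w i) 1) {I : Ideal (MvPolynomial σ K)}
    (hI : ∀ m m' : σ →₀ ℕ,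
      Finsupp.linearCombination ℕ w m = Finsupp.linearCombination ℕ w m' →
        Ideal.Quotient.mk I (monomial m 1) = Ideal.Quotient.mk I (monomial m' 1)) :
    RingHom.ker φ ≤ I := by
  intro f hf
  set h := Finsupp.linearCombination ℕ w
  -- `L` lifts a monomial to some preimage; by `hI` the class does not depend on the choice, so the
  -- quotient map factors through `φ`.
  let L : MvPolynomial τ K →ₗ[K] (MvPolynomial σ K ⧸ I) :=
    (basisMonomials τ K).constr K
      (fun v => Ideal.Quotient.mk I (monomial (Function.invFun h v) 1))
  have hL : ∀ v, L (monomial v 1) = Ideal.Quotient.mk I (monomial (Function.invFun h v) 1) := by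
    intro v
    have := (basisMonomials τ K).constr_basis K
      (fun v => Ideal.Quotient.mk I (monomial (Function.invFun h v) (1 : K))) v
    simpa only [coe_basisMonomials] using this
  have key : L ∘ₗ φ.toLinearMap = (Ideal.Quotient.mkₐ K I).toLinearMap := by
    refine (basisMonomials σ K).ext fun m => ?_
    simp only [coe_basisMonomials, LinearMap.comp_apply, AlgHom.toLinearMap_apply,
      map_monomial_of_map_X hφ, Ideal.Quotient.mkₐ_eq_mk]
    rw [hL]
    exact hI _ _ (Function.invFun_eq (f := h) ⟨m, rfl⟩)
  have := LinearMap.congr_fun key f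
  rw [← Ideal.Quotient.eq_zero_iff_mem]
  simp only [LinearMap.comp_apply, AlgHom.toLinearMap_apply, Ideal.Quotient.mkₐ_eq_mk] at this
  rw [← this, (RingHom.mem_ker).1 hf, map_zero]

/-- Each monomial in the image is the image of a monomial. -/
theorem exists_mem_support_of_map_X {φ : MvPolynomial σ K →ₐ[K] MvPolynomial τ K}
    {w : σ → τ →₀ ℕ} (hφ : ∀ i, φ (X i) = monomial (w i) 1) {f : MvPolynomial σ K} {v : τ →₀ ℕ}
    (hv : coeff v (φ f) ≠ 0) : ∃ m ∈ f.support, Finsupp.linearCombination ℕ w m = v := by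
  classical
  rw [f.as_sum, map_sum, coeff_sum] at hv
  obtain ⟨m, hm, hne⟩ := Finset.exists_ne_zero_of_sum_ne_zero hv
  rw [map_monomial_of_map_X hφ, coeff_monomial] at hne
  exact ⟨m, hm, by_contra fun h => hne (if_neg h)⟩

open Classical in
/-- The homomorphism that sets the variables outside `s` to zero. -/
noncomputable def restrictVars (K : Type*) [Field K] (s : Set τ) :
    MvPolynomial τ K →ₐ[K] MvPolynomial τ K :=
  aeval fun i => if i ∈ s then X i else 0

theorem coeff_restrictVars {s : Set τ} {v : τ →₀ ℕ} (hv : ∀ i, v i ≠ 0 → i ∈ s)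
    (g : MvPolynomial τ K) : coeff v (restrictVars K s g) = coeff v g := by
  classical
  induction g using MvPolynomial.induction_on' with
  | add p q hp hq => rw [map_add, coeff_add, coeff_add, hp, hq]
  | monomial m c =>
    rw [restrictVars, aeval_monomial]
    by_cases hm : ∀ i, m i ≠ 0 → i ∈ s
    · have : (m.prod fun i k => (if i ∈ s then X i else 0 : MvPolynomial τ K) ^ k) =
          m.prod fun i k => X i ^ k :=
        Finsupp.prod_congr fun i hi => by rw [if_pos (hm i (Finsupp.mem_support_iff.1 hi))]
      rw [this, monomial_eq, algebraMap_eq]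
    · push Not at hm
      obtain ⟨i, hi, his⟩ := hm
      have : (m.prod fun i k => (if i ∈ s then X i else 0 : MvPolynomial τ K) ^ k) = 0 :=
        Finset.prod_eq_zero (Finsupp.mem_support_iff.2 hi) (by simp [his, hi])
      rw [this, mul_zero, coeff_zero, coeff_monomial, if_neg]
      rintro rfl
      exact his (hv i hi)

end Monomials

/-- If the vectors `X` and `Y` are proportional, then a monomial in them depends only on its
multidegree and its degree in `Y`. -/
theorem prod_pow_mul_prod_pow_eq {ι Q : Type*} [Fintype ι] [DecidableEq ι] [CommRing Q]
    {X Y : ι → Q} (hXY : ∀ i j, X i * Y j = X j * Y i) {a b a' b' : ι → ℕ}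
    (hab : a + b = a' + b') (hb : ∑ i, b i = ∑ i, b' i) :
    (∏ i, X i ^ a i) * ∏ i, Y i ^ b i = (∏ i, X i ^ a' i) * ∏ i, Y i ^ b' i := by
  have split : ∀ (c : ι → ℕ) (i : ι), c i ≠ 0 → ∃ c' : ι → ℕ, c = c' + Pi.single i 1 := by
    intro c i hi
    refine ⟨c - Pi.single i 1, funext fun j => ?_⟩
    rcases eq_or_ne j i with rfl | hj
    · simp; omega
    · simp [hj]
  have prod_single : ∀ (Z : ι → Q) (c : ι → ℕ) (i : ι),
      ∏ j, Z j ^ (c + Pi.single i 1 : ι → ℕ) j = (∏ j, Z j ^ c j) * Z i := by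
    intro Z c i
    simp only [Pi.add_apply, pow_add, Finset.prod_mul_distrib]
    congr 1
    rw [Finset.prod_eq_single i (fun j _ hj => by simp [hj]) (by simp)]
    simp
  have sum_single : ∀ (c : ι → ℕ) (i : ι),
      ∑ j, (c + Pi.single i 1 : ι → ℕ) j = (∑ j, c j) + 1 := by
    intro c i
    simp [Finset.sum_add_distrib]
  have exists_ne : ∀ c : ι → ℕ, ∑ i, c i ≠ 0 → ∃ i, c i ≠ 0 := fun c hc =>
    (Finset.exists_ne_zero_of_sum_ne_zero hc).imp fun _ h => h.2
  obtain ⟨k, hk⟩ : ∃ k, ∑ i, b i = k := ⟨_, rfl⟩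
  induction k generalizing a b a' b' with
  | zero =>
    have h0 : ∀ c : ι → ℕ, ∑ i, c i = 0 → c = 0 := fun c hc =>
      funext fun i => (Finset.sum_eq_zero_iff.1 hc) i (Finset.mem_univ i)
    obtain rfl := h0 b hk
    obtain rfl := h0 b' (hb ▸ hk)
    rw [add_zero, add_zero] at hab
    rw [hab]
  | succ k ih =>
    obtain ⟨i, hi⟩ := exists_ne b (by omega)
    obtain ⟨b, rfl⟩ := split b i hi
    rw [sum_single] at hb hk
    -- To cancel `Y i` on both sides when the right one lacks it, trade `X i * Y j` for `X j * Y i`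
    -- there.
    by_cases hi' : b' i = 0
    · have hai : a' i ≠ 0 := by
        have := congrFun hab i
        simp at this
        omega
      obtain ⟨a', rfl⟩ := split a' i hai
      obtain ⟨j, hj⟩ := exists_ne b' (by omega)
      obtain ⟨b', rfl⟩ := split b' j hj
      rw [sum_single] at hb
      have := @ih a b (a' + Pi.single j 1) b'
        (add_right_cancel (b := Pi.single i 1) (by rw [add_assoc, hab]; abel)) (by omega) (by omega)
      rw [prod_single] at this
      rw [prod_single, prod_single, prod_single, ← mul_assoc, this]
      linear_combination (-(∏ i, X i ^ a' i) * ∏ i, Y i ^ b' i) * hXY i j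
    · obtain ⟨b', rfl⟩ := split b' i hi'
      rw [sum_single] at hb
      have := @ih a b a' b'
        (add_right_cancel (b := Pi.single i 1) (by rw [add_assoc, hab, add_assoc]))
        (by omega) (by omega)
      rw [prod_single, prod_single, ← mul_assoc, ← mul_assoc, this]

/-! ### Minors, parametrizations and primality of `J_{Kₙ}` -/

variable {K : Type*} [Field K] {n : ℕ}

/-- The binomial `xᵢ yⱼ - xⱼ yᵢ`. -/
noncomputable def minor (K : Type*) [Field K] {n : ℕ} (i j : Fin n) : PolyRing K n :=
  x K i * y K j - x K j * y K i

theorem minor_self (i : Fin n) : minor K i i = 0 := sub_self _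

theorem minor_comm (i j : Fin n) : minor K i j = -minor K j i := by
  simp only [minor]; ring

/-- Expansion of the vanishing 3×3 determinant with rows `x, x, y` and columns `b, i, j`. -/
theorem x_mul_minor (b i j : Fin n) :
    x K b * minor K i j = x K i * minor K b j - x K j * minor K b i := by
  simp only [minor]; ring

theorem minor_mem {G : SimpleGraph (Fin n)} {i j : Fin n} (h : G.Adj i j) :
    minor K i j ∈ edgeIdeal K G := by
  rcases lt_or_gt_of_ne h.ne with hij | hij
  · exact Ideal.subset_span ⟨i, j, hij, h, rfl⟩
  · rw [minor_comm]
    exact neg_mem (Ideal.subset_span ⟨j, i, hij, h.symm, rfl⟩)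

theorem minor_mem_top (i j : Fin n) : minor K i j ∈ edgeIdeal K (⊤ : SimpleGraph (Fin n)) := by
  rcases eq_or_ne i j with rfl | h
  · rw [minor_self]; exact zero_mem _
  · exact minor_mem h

theorem edgeIdeal_le {G : SimpleGraph (Fin n)} {I : Ideal (PolyRing K n)}
    (h : ∀ i j, G.Adj i j → minor K i j ∈ I) : edgeIdeal K G ≤ I := by
  refine Ideal.span_le.2 ?_
  rintro _ ⟨i, j, -, hij, rfl⟩
  exact h i j hij

theorem edgeIdeal_le_top (G : SimpleGraph (Fin n)) :
    edgeIdeal K G ≤ edgeIdeal K (⊤ : SimpleGraph (Fin n)) :=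
  edgeIdeal_le fun i j _ => minor_mem_top i j

open Classical in
/-- The parametrization `xᵢ ↦ uᵢ`, `yᵢ ↦ t_{c i} uᵢ` for `i ∈ U`, and `xᵢ, yᵢ ↦ 0` for `i ∉ U`. Its
kernel is the prime attached to the complement of `U` if `c` separates the components of `U`. -/
noncomputable def param (K : Type*) [Field K] {n : ℕ} (U : Set (Fin n)) (c : Fin n → Bool) :
    PolyRing K n →ₐ[K] MvPolynomial (Bool ⊕ Fin n) K :=
  aeval (Sum.elim (fun i => if i ∈ U then X (Sum.inr i) else 0)
    (fun i => if i ∈ U then X (Sum.inl (c i)) * X (Sum.inr i) else 0))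

theorem param_x {U : Set (Fin n)} {i : Fin n} (hi : i ∈ U) (c : Fin n → Bool) :
    param K U c (x K i) = X (Sum.inr i) := by
  simp [param, x, hi]

theorem param_y {U : Set (Fin n)} {i : Fin n} (hi : i ∈ U) (c : Fin n → Bool) :
    param K U c (y K i) = X (Sum.inl (c i)) * X (Sum.inr i) := by
  simp [param, y, hi]

theorem param_x_of_notMem {U : Set (Fin n)} {i : Fin n} (hi : i ∉ U) (c : Fin n → Bool) :
    param K U c (x K i) = 0 := by
  simp [param, x, hi]

theorem param_y_of_notMem {U : Set (Fin n)} {i : Fin n} (hi : i ∉ U) (c : Fin n → Bool) :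
    param K U c (y K i) = 0 := by
  simp [param, y, hi]

theorem param_minor {U : Set (Fin n)} {i j : Fin n} (hi : i ∈ U) (hj : j ∈ U) (c : Fin n → Bool) :
    param K U c (minor K i j) =
      (X (Sum.inl (c j)) - X (Sum.inl (c i))) * (X (Sum.inr i) * X (Sum.inr j)) := by
  rw [minor, map_sub, map_mul, map_mul, param_x hi, param_x hj, param_y hi, param_y hj]
  ring

theorem edgeIdeal_le_ker_param {G : SimpleGraph (Fin n)} {U : Set (Fin n)} {c : Fin n → Bool}
    (h : ∀ i ∈ U, ∀ j ∈ U, G.Adj i j → c i = c j) :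
    edgeIdeal K G ≤ RingHom.ker (param K U c) := by
  refine edgeIdeal_le fun i j hij => ?_
  rw [RingHom.mem_ker]
  by_cases hi : i ∈ U
  · by_cases hj : j ∈ U
    · rw [param_minor hi hj, h i hi j hj hij, sub_self, zero_mul]
    · simp [minor, param_x_of_notMem hj, param_y_of_notMem hj]
  · simp [minor, param_x_of_notMem hi, param_y_of_notMem hi]

theorem param_minor_ne_zero {U : Set (Fin n)} {i j : Fin n} (hi : i ∈ U) (hj : j ∈ U)
    {c : Fin n → Bool} (hc : c i ≠ c j) : param K U c (minor K i j) ≠ 0 := by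
  rw [param_minor hi hj]
  refine mul_ne_zero (sub_ne_zero.2 fun h => hc ?_) (mul_ne_zero (X_ne_zero _) (X_ne_zero _))
  exact (Sum.inl_injective (X_injective h)).symm

/-- The exponents of the parametrization of `J_{Kₙ}`. -/
noncomputable def paramExp (n : ℕ) : Fin n ⊕ Fin n → (Bool ⊕ Fin n →₀ ℕ) :=
  Sum.elim (fun i => Finsupp.single (Sum.inr i) 1)
    (fun i => Finsupp.single (Sum.inl true) 1 + Finsupp.single (Sum.inr i) 1)

theorem param_univ_X (i : Fin n ⊕ Fin n) :
    param K Set.univ (fun _ => true) (X i) = monomial (paramExp n i) 1 := by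
  rcases i with i | i
  · exact param_x (Set.mem_univ i) _
  · refine (param_y (Set.mem_univ i) _).trans ?_
    simp [paramExp, X, monomial_mul]

theorem linearCombination_paramExp_inr (m : Fin n ⊕ Fin n →₀ ℕ) (i : Fin n) :
    Finsupp.linearCombination ℕ (paramExp n) m (Sum.inr i) = m (Sum.inl i) + m (Sum.inr i) := by
  rw [Finsupp.linearCombination_apply, Finsupp.sum_fintype _ _ (by simp), Fintype.sum_sum_type]
  simp [paramExp, Finsupp.single_apply]

theorem linearCombination_paramExp_inl (m : Fin n ⊕ Fin n →₀ ℕ) :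
    Finsupp.linearCombination ℕ (paramExp n) m (Sum.inl true) = ∑ i, m (Sum.inr i) := by
  rw [Finsupp.linearCombination_apply, Finsupp.sum_fintype _ _ (by simp), Fintype.sum_sum_type]
  simp [paramExp]

/-- Monomials with equal image share their multidegree and `y`-degree, so they agree modulo the
minors. Primality follows, the target being a domain. -/
theorem ker_param_univ :
    RingHom.ker (param K Set.univ (fun _ => true)) = edgeIdeal K (⊤ : SimpleGraph (Fin n)) := by
  refine le_antisymm (ker_le_of_map_X param_univ_X fun m m' h => ?_)
    (edgeIdeal_le_ker_param fun _ _ _ _ _ => rfl)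
  have hprod : ∀ m : Fin n ⊕ Fin n →₀ ℕ, (monomial m 1 : PolyRing K n) =
      (∏ i, x K i ^ m (Sum.inl i)) * ∏ i, y K i ^ m (Sum.inr i) := by
    intro m
    rw [monomial_eq, C_1, one_mul, Finsupp.prod_fintype _ _ fun i => pow_zero _,
      Fintype.prod_sum_type]
    rfl
  rw [hprod, hprod]
  simp only [map_mul, map_prod, map_pow]
  refine prod_pow_mul_prod_pow_eq (fun i j => ?_) (funext fun i => ?_) ?_
  · rw [← map_mul, ← map_mul, Ideal.Quotient.eq]
    exact minor_mem_top i j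
  · simpa [linearCombination_paramExp_inr] using DFunLike.congr_fun h (Sum.inr i)
  · simpa only [linearCombination_paramExp_inl] using DFunLike.congr_fun h (Sum.inl true)

theorem isPrime_edgeIdeal_top : (edgeIdeal K (⊤ : SimpleGraph (Fin n))).IsPrime := by
  rw [← ker_param_univ]
  exact RingHom.ker_isPrime _

/-! ### Upper bound: products over connected dominating sets -/

theorem prod_x_notMem (B : Finset (Fin n)) :
    ∏ b ∈ B, x K b ∉ edgeIdeal K (⊤ : SimpleGraph (Fin n)) := by
  rw [← ker_param_univ, RingHom.mem_ker, map_prod]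
  refine Finset.prod_ne_zero_iff.2 fun b _ => ?_
  rw [param_x (Set.mem_univ b)]
  exact X_ne_zero _

theorem isHomogeneous_prod_x (B : Finset (Fin n)) :
    (∏ b ∈ B, x K b).IsHomogeneous B.card := by
  have := IsHomogeneous.prod B (fun b => x K b) (fun _ => 1) fun b _ => isHomogeneous_X K _
  simpa using this

/-- Along a path, the product of the `x`-variables of its vertices multiplies `xᵢ yⱼ - xⱼ yᵢ` into
`J_G` if `i` and `j` are joined to its ends. -/
theorem prod_support_mul_minor_mem {G : SimpleGraph (Fin n)} {s : Set (Fin n)} {b c : s}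
    (p : (G.induce s).Walk b c) {i j : Fin n} (hi : minor K b i ∈ edgeIdeal K G)
    (hj : minor K c j ∈ edgeIdeal K G) :
    (p.support.map fun v : s => x K (v : Fin n)).prod * minor K i j ∈ edgeIdeal K G := by
  induction p generalizing i with
  | nil =>
    simp only [SimpleGraph.Walk.support_nil, List.map_cons, List.map_nil, List.prod_cons,
      List.prod_nil, mul_one]
    rw [x_mul_minor]
    exact sub_mem (Ideal.mul_mem_left _ _ hj) (Ideal.mul_mem_left _ _ hi)
  | @cons b b' c h p ih =>
    rw [SimpleGraph.Walk.support_cons, List.map_cons, List.prod_cons, mul_right_comm, x_mul_minor,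
      sub_mul]
    have h' : minor K (b' : Fin n) b ∈ edgeIdeal K G := minor_mem (G := G) h.symm
    refine sub_mem ?_ (Ideal.mul_mem_right _ _ (Ideal.mul_mem_left _ _ hi))
    have := ih h' hj
    rw [mul_assoc, mul_comm (minor K _ _)]
    exact Ideal.mul_mem_left _ _ this

theorem prod_x_mul_minor_mem {G : SimpleGraph (Fin n)} {B : Finset (Fin n)}
    (hB : IsConnectedDominating G B) (i j : Fin n) :
    (∏ b ∈ B, x K b) * minor K i j ∈ edgeIdeal K G := by
  classical
  have near : ∀ v, ∃ b : (B : Set (Fin n)), minor K (b : Fin n) v ∈ edgeIdeal K G := by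
    intro v
    by_cases hv : v ∈ B
    · exact ⟨⟨v, hv⟩, by rw [minor_self]; exact zero_mem _⟩
    · obtain ⟨w, hw, h⟩ := hB.2 v hv
      exact ⟨⟨w, hw⟩, minor_mem h.symm⟩
  obtain ⟨b, hb⟩ := near i
  obtain ⟨c, hc⟩ := near j
  -- A path repeats no vertex, so its product divides the product over `B`.
  obtain ⟨p, hp⟩ := (hB.1.preconnected b c).exists_isPath
  have hmem := prod_support_mul_minor_mem p hb hc
  have hnodup : (p.support.map Subtype.val).Nodup :=
    hp.support_nodup.map Subtype.val_injective
  have hdvd : (p.support.map fun v : (B : Set (Fin n)) => x K (v : Fin n)).prod ∣ ∏ b ∈ B, x K b := by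
    have : (p.support.map fun v : (B : Set (Fin n)) => x K (v : Fin n)).prod =
        ∏ b ∈ (p.support.map Subtype.val).toFinset, x K b := by
      rw [List.prod_toFinset _ hnodup, List.map_map]
      rfl
    rw [this]
    refine Finset.prod_dvd_prod_of_subset _ _ _ fun v hv => ?_
    simp only [List.mem_toFinset, List.mem_map] at hv
    obtain ⟨w, -, rfl⟩ := hv
    exact w.2
  obtain ⟨r, hr⟩ := hdvd
  rw [hr, mul_right_comm]
  exact Ideal.mul_mem_right _ _ hmem

theorem colon_prod_x {G : SimpleGraph (Fin n)} {B : Finset (Fin n)}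
    (hB : IsConnectedDominating G B) :
    (edgeIdeal K G).colon {∏ b ∈ B, x K b} = edgeIdeal K (⊤ : SimpleGraph (Fin n)) := by
  refine le_antisymm (fun g hg => ?_) (edgeIdeal_le fun i j _ => ?_)
  · rw [Submodule.mem_colon_singleton, smul_eq_mul] at hg
    exact (isPrime_edgeIdeal_top.mem_or_mem (edgeIdeal_le_top G hg)).resolve_right
      (prod_x_notMem B)
  · rw [Submodule.mem_colon_singleton, smul_eq_mul, mul_comm]
    exact prod_x_mul_minor_mem hB i j

/-! ### Lower bound: separating colourings -/

/-- If `(J_G : f) = J_{Kₙ}`, and `c` separates two vertices of some `U ⊇ B` but no adjacent ones, then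
the restriction of `f` to the variables of `B` lies in `J_{Kₙ}`. -/
theorem restrictVars_param_eq_zero {G : SimpleGraph (Fin n)} {f : PolyRing K n}
    (hf : (edgeIdeal K G).colon {f} = edgeIdeal K (⊤ : SimpleGraph (Fin n)))
    {U B : Set (Fin n)} (hBU : B ⊆ U) {c : Fin n → Bool}
    (hc : ∀ i ∈ U, ∀ j ∈ U, G.Adj i j → c i = c j) {i j : Fin n} (hi : i ∈ U) (hj : j ∈ U)
    (hij : c i ≠ c j) :
    restrictVars K (Set.range Sum.inl ∪ Sum.inr '' B) (param K Set.univ (fun _ => true) f) = 0 := by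
  classical
  have hfU : param K U c f = 0 := by
    have h : minor K i j ∈ (edgeIdeal K G).colon {f} := hf ▸ minor_mem_top i j
    rw [Submodule.mem_colon_singleton, smul_eq_mul] at h
    have := edgeIdeal_le_ker_param hc h
    rw [RingHom.mem_ker, map_mul] at this
    exact (mul_eq_zero.1 this).resolve_left (param_minor_ne_zero hi hj hij)
  -- `M` merges the two parameters; once the `uᵢ` outside `B` vanish, the colouring is invisible.
  let M : MvPolynomial (Bool ⊕ Fin n) K →ₐ[K] MvPolynomial (Bool ⊕ Fin n) K :=
    aeval (Sum.elim (fun _ => X (Sum.inl true)) fun i => if i ∈ B then X (Sum.inr i) else 0)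
  have key : (restrictVars K (Set.range Sum.inl ∪ Sum.inr '' B)).comp
      (param K Set.univ (fun _ => true)) = M.comp (param K U c) := by
    refine algHom_ext fun v => ?_
    rcases v with v | v <;> by_cases hB : v ∈ B <;> by_cases hU : v ∈ U <;>
      first
      | exact absurd (hBU hB) hU
      | simp [param, restrictVars, M, hB, hU]
  have := DFunLike.congr_fun key f
  simp only [AlgHom.comp_apply] at this
  rw [this, hfU, map_zero]

/-- Otherwise `f` lies in `(J_G : ∏ x_b)`, so by symmetry `∏ x_b` lies in `(J_G : f) = J_{Kₙ}`,
which is impossible. -/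
theorem notMem_of_colon_eq {G : SimpleGraph (Fin n)} (hG : G.Connected) {f : PolyRing K n}
    (hf : (edgeIdeal K G).colon {f} = edgeIdeal K (⊤ : SimpleGraph (Fin n))) :
    f ∉ edgeIdeal K (⊤ : SimpleGraph (Fin n)) := by
  obtain ⟨B, hB, -⟩ := exists_card_eq_connectedDominationNumber hG
  intro h
  rw [← colon_prod_x hB, Submodule.mem_colon_singleton, smul_eq_mul, mul_comm, ← smul_eq_mul,
    ← Submodule.mem_colon_singleton, hf] at h
  exact prod_x_notMem B h

/-- A homogeneous `f` with `(J_G : f) = J_{Kₙ}` yields a connected dominating set with at most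
`deg f` elements. -/
theorem exists_isConnectedDominating_card_le {G : SimpleGraph (Fin n)} (hG : G.Connected)
    (hne : G ≠ ⊤) {f : PolyRing K n} {d : ℕ} (hd : f.IsHomogeneous d)
    (hf : (edgeIdeal K G).colon {f} = edgeIdeal K (⊤ : SimpleGraph (Fin n))) :
    ∃ B, IsConnectedDominating G B ∧ B.card ≤ d := by
  classical
  have hf0 : param K Set.univ (fun _ => true) f ≠ 0 := by
    rw [Ne, ← RingHom.mem_ker, ker_param_univ]
    exact notMem_of_colon_eq hG hf
  obtain ⟨v, hv⟩ := exists_coeff_ne_zero hf0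
  obtain ⟨m, hm, hmv⟩ := exists_mem_support_of_map_X param_univ_X hv
  set B : Finset (Fin n) := Finset.univ.filter fun i => v (Sum.inr i) ≠ 0 with hBdef
  have hBsep : ∀ (U : Set (Fin n)) (c : Fin n → Bool), (B : Set (Fin n)) ⊆ U →
      (∀ i ∈ U, ∀ j ∈ U, G.Adj i j → c i = c j) → ∀ i ∈ U, ∀ j ∈ U, c i = c j := by
    intro U c hBU hc i hi j hj
    by_contra hij
    have h0 := restrictVars_param_eq_zero hf hBU hc hi hj hij
    apply hv
    rw [← coeff_restrictVars (s := Set.range Sum.inl ∪ Sum.inr '' (B : Set (Fin n))), h0,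
      coeff_zero]
    rintro (t | k) hk
    · exact Or.inl ⟨t, rfl⟩
    · exact Or.inr ⟨k, by simpa [hBdef] using hk, rfl⟩
  have hBne : B.Nonempty := by
    by_contra hB
    rw [Finset.not_nonempty_iff_eq_empty] at hB
    -- Only here is `G ≠ ⊤` needed: two nonadjacent vertices separate the empty set.
    obtain ⟨a, b, hab, hnadj⟩ := SimpleGraph.ne_top_iff_exists_not_adj.1 hne
    have := hBsep {a, b} (fun k => decide (k = a)) (by simp [hB])
      (by
        rintro i (rfl | rfl) j (rfl | rfl) hij
        · rfl
        · exact absurd hij hnadj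
        · exact absurd hij.symm hnadj
        · rfl) a (by simp) b (by simp)
    simp at this
    exact hab this.symm
  refine ⟨B, ⟨?_, fun w hw => ?_⟩, ?_⟩
  · have : Nonempty (B : Set (Fin n)) := hBne.to_subtype
    refine SimpleGraph.Connected.mk fun a b => ?_
    -- Colour by membership in the component of `a`.
    have h := hBsep B
      (fun k => decide (∃ hk : k ∈ (B : Set (Fin n)),
        (G.induce (B : Set (Fin n))).Reachable a ⟨k, hk⟩))
      subset_rfl
      (fun i hi j hj hij => by
        have hadj : (G.induce (B : Set (Fin n))).Adj ⟨i, hi⟩ ⟨j, hj⟩ := hij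
        rw [decide_eq_decide]
        exact ⟨fun ⟨_, h⟩ => ⟨hj, h.trans hadj.reachable⟩,
          fun ⟨_, h⟩ => ⟨hi, h.trans hadj.symm.reachable⟩⟩)
      a a.2 b b.2
    rw [decide_eq_decide] at h
    exact (h.1 ⟨a.2, SimpleGraph.Reachable.refl _⟩).2
  · by_contra! hnadj
    obtain ⟨b, hb⟩ := hBne
    -- An undominated `w` is isolated in `B ∪ {w}`, so it can have its own colour.
    have := hBsep (insert w (B : Set (Fin n))) (fun k => decide (k = w)) (Set.subset_insert _ _)
      (by
        rintro i (rfl | hi) j (rfl | hj) hij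
        · rfl
        · exact absurd hij (hnadj j hj)
        · exact absurd hij.symm (hnadj i hi)
        · rw [decide_eq_decide]
          exact ⟨fun h => absurd (h ▸ hi) hw, fun h => absurd (h ▸ hj) hw⟩)
      w (Set.mem_insert _ _) b (Set.mem_insert_of_mem _ hb)
    simp at this
    exact hw (this ▸ hb)
  · have hdeg : m.degree = d := by
      by_contra h
      exact (mem_support_iff.1 hm) (hd.coeff_eq_zero h)
    calc B.card = ∑ i ∈ B, 1 := by simp
      _ ≤ ∑ i ∈ B, v (Sum.inr i) :=
        Finset.sum_le_sum fun i hi => Nat.one_le_iff_ne_zero.2 (Finset.mem_filter.1 hi).2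
      _ ≤ ∑ i, v (Sum.inr i) := Finset.sum_le_univ_sum_of_nonneg fun _ => Nat.zero_le _
      _ = ∑ i, (m (Sum.inl i) + m (Sum.inr i)) := by
        simp only [← hmv, linearCombination_paramExp_inr]
      _ = d := by
        rw [← hdeg, Finsupp.degree_eq_sum, Fintype.sum_sum_type, Finset.sum_add_distrib]

end BinomialEdge

theorem theorem3p8 (K : Type*) [Field K] (n : ℕ) (G : SimpleGraph (Fin n)) (hG : G.Connected) :
    BinomialEdge.edgeIdeal K (⊤ : SimpleGraph (Fin n)) ∈
        BinomialEdge.Ass (BinomialEdge.edgeIdeal K G) ∧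
      (G ≠ ⊤ →
        BinomialEdge.localVNumber (BinomialEdge.edgeIdeal K G)
            (BinomialEdge.edgeIdeal K (⊤ : SimpleGraph (Fin n))) =
          BinomialEdge.connectedDominationNumber G) ∧
      (G = ⊤ →
        BinomialEdge.localVNumber (BinomialEdge.edgeIdeal K G)
            (BinomialEdge.edgeIdeal K (⊤ : SimpleGraph (Fin n))) = 0) := by
  open BinomialEdge in
  obtain ⟨B, hB, hcard⟩ := exists_card_eq_connectedDominationNumber hG
  have hmem : B.card ∈ colonDegrees (edgeIdeal K G) (edgeIdeal K ⊤) :=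
    ⟨_, isHomogeneous_prod_x B, colon_prod_x hB⟩
  have hAss : edgeIdeal K (⊤ : SimpleGraph (Fin n)) ∈ Ass (edgeIdeal K G) :=
    ⟨isPrime_edgeIdeal_top, B.card, hmem⟩
  refine ⟨hAss, fun hne => le_antisymm ?_ ?_, ?_⟩
  · rw [← hcard]
    exact Nat.sInf_le hmem
  · obtain ⟨f, hd, hf⟩ := localVNumber_mem hAss
    obtain ⟨B', hB', hle⟩ :=
      exists_isConnectedDominating_card_le hG hne hd hf
    have hmem' : B'.card ∈ {k | ∃ B : Finset (Fin n), IsConnectedDominating G B ∧ B.card = k} :=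
      ⟨B', hB', rfl⟩
    exact (Nat.sInf_le hmem').trans hle
  · rintro rfl
    suffices h : 0 ∈ colonDegrees (edgeIdeal K (⊤ : SimpleGraph (Fin n))) (edgeIdeal K ⊤) from
      Nat.le_zero.1 (Nat.sInf_le h)
    -- For the complete graph, `f = 1` works.
    refine ⟨1, MvPolynomial.isHomogeneous_one _ _, ?_⟩
    ext g
    rw [Submodule.mem_colon_singleton, smul_eq_mul, mul_one]
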